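/- Let $\mathcal X$ be a finite set, let $\mathcal H_X=\mathbb C^{\mathcal X}$ with standard orthonormal basis $\{|x\rangle\}$, and let $\mathcal H_B$ be a finite-dimensional Hilbert space. A sub-normalized state is a positive semi-definite operator $\rho$ with $0<\operatorname{tr}\rho\le 1$; it is normalized if $\operatorname{tr}\rho=1$. An operator on $\mathcal H_X\otimes\mathcal H_B$ is CQ if it has the form $\sum_x |x\rangle\langle x|\otimes\rho_B^{[x]}$ with all $\rho_B^{[x]}\ge 0$. Logarithms are binary, and inverses of positive semi-definite operators are taken on the support. Define $$H_{\min}(X|B)_\rho:=\sup_{\sigma_B\ \text{normalized}}\ \sup\{\lambda\in\mathbb R:\rho_{XB}\le 2^{-\lambda}\,1_X\otimes\sigma_B\},\qquad \Gamma_C(\rho_{XB}|\sigma_B):=\operatorname{tr}\Big(\big(\rho_{XB}(1_X\otimes\sigma_B^{-1/2})\big)^2\Big),$$ $$P(\rho,\tau):=\sqrt{1-\bar F(\rho,\tau)^2},\qquad \bar F(\rho,\tau):=\operatorname{tr}\big|\sqrt\rho\sqrt\tau\big|+\sqrt{(1-\operatorname{tr}\rho)(1-\operatorname{tr}\tau)}.$$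 Let $\rho_{XB}$ be a sub-normalized CQ state. Then $H_{\min}(X|B)_\rho$ is finite and there exists a normalized state $\sigma_B$ such that $$\Gamma_C(\rho_{XB}|\sigma_B)\le 2^{-H_{\min}(X|B)_\rho}.$$ Moreover, for every $\bar\varepsilon>0$ there exists a sub-normalized CQ state $\bar\rho_{XB}$ with $\operatorname{tr}\bar\rho_{XB}=\operatorname{tr}\rho_{XB}$ (in particular, $\bar\rho_{XB}$ is normalized if $\rho_{XB}$ is) and $P(\rho_{XB},\bar\rho_{XB})\le\bar\varepsilon$ such that, with $\bar\rho_B=\operatorname{tr}_X\bar\rho_{XB}$, $$\Gamma_C(\bar\rho_{XB}|\bar\rho_B)\le 2^{-H_{\min}(X|B)_\rho+\log\left(\frac{2}{\bar\varepsilon^2}+1\right)}.$$ -/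

import Mathlib

open scoped Kronecker ComplexOrder

noncomputable section

/-- Normalized states on the Hilbert space `ℂⁿ`: positive semi-definite with trace one. -/
def IsNormState {n : Type*} [Fintype n] (ρ : Matrix n n ℂ) : Prop :=
  ρ.PosSemidef ∧ ρ.trace = 1

/-- Sub-normalized states on `ℂⁿ`: positive semi-definite with `0 < tr ρ ≤ 1`
(the trace of a positive semi-definite matrix is real). -/
def IsSubnormState {n : Type*} [Fintype n] (ρ : Matrix n n ℂ) : Prop :=
  ρ.PosSemidef ∧ 0 < ρ.trace.re ∧ ρ.trace.re ≤ 1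

/-- The square root of a positive semi-definite matrix (functional calculus). -/
def psdSqrt {n : Type*} [Fintype n] [DecidableEq n] (ρ : Matrix n n ℂ) : Matrix n n ℂ :=
  cfc Real.sqrt ρ

/-- The generalized inverse square root `σ^(-1/2)` of a positive semi-definite matrix, taken on
the support of `σ`: functional calculus for the function that is `x^(-1/2)` for `x ≠ 0` and `0`
for `x = 0`. -/
def psdInvSqrt {n : Type*} [Fintype n] [DecidableEq n] (σ : Matrix n n ℂ) : Matrix n n ℂ :=
  cfc (fun x : ℝ => if x = 0 then 0 else (Real.sqrt x)⁻¹) σ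

/-- The absolute value `|M| = √(M† M)`. -/
def matrixAbs {n : Type*} [Fintype n] [DecidableEq n] (M : Matrix n n ℂ) : Matrix n n ℂ :=
  psdSqrt (M.conjTranspose * M)

/-- The generalized fidelity
`F̄(ρ, τ) = tr |√ρ √τ| + √((1 - tr ρ) (1 - tr τ))` of sub-normalized states. -/
def genFidelity {n : Type*} [Fintype n] [DecidableEq n] (ρ τ : Matrix n n ℂ) : ℝ :=
  (matrixAbs (psdSqrt ρ * psdSqrt τ)).trace.re
    + Real.sqrt ((1 - ρ.trace.re) * (1 - τ.trace.re))

/-- The purified distance `P(ρ, τ) = √(1 - F̄(ρ, τ)²)`. -/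
def purifiedDist {n : Type*} [Fintype n] [DecidableEq n] (ρ τ : Matrix n n ℂ) : ℝ :=
  Real.sqrt (1 - genFidelity ρ τ ^ 2)

/-- The ball of sub-normalized states at purified distance at most `ε` from `ρ`. -/
def epsBall {n : Type*} [Fintype n] [DecidableEq n] (ε : ℝ) (ρ : Matrix n n ℂ) :
    Set (Matrix n n ℂ) :=
  {τ | IsSubnormState τ ∧ purifiedDist ρ τ ≤ ε}

/-- The marginal `ρ_B = tr_A ρ_AB` (partial trace over the first system). -/
def marginalB {A B : Type*} [Fintype A] (ρ : Matrix (A × B) (A × B) ℂ) : Matrix B B ℂ :=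
  Matrix.of fun i j => ∑ a, ρ (a, i) (a, j)

/-- A positive semi-definite matrix on `ℂ^X ⊗ ℂ^B` is classical-quantum if it is of the form
`∑ x, |x⟩⟨x| ⊗ ρ_B^[x]` with positive semi-definite `ρ_B^[x]`, where `|x⟩` is the standard
basis of `ℂ^X`. -/
def IsCQ {X B : Type*} [Fintype X] [DecidableEq X] [Fintype B]
    (ρ : Matrix (X × B) (X × B) ℂ) : Prop :=
  ∃ r : X → Matrix B B ℂ, (∀ x, (r x).PosSemidef) ∧
    ρ = ∑ x, Matrix.single x x (1 : ℂ) ⊗ₖ r x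

/-- `sup {l ∈ ℝ : ρ_AB ≤ 2^(-l) 1_A ⊗ σ_B}`, in the extended reals
(so that it is `-∞` if no such `l` exists). -/
def condMinEntropyRel {A B : Type*} [Fintype A] [DecidableEq A] [Fintype B]
    (ρ : Matrix (A × B) (A × B) ℂ) (σ : Matrix B B ℂ) : EReal :=
  ⨆ l : {l : ℝ // ((((2 : ℝ) ^ (-l) : ℝ) : ℂ) • ((1 : Matrix A A ℂ) ⊗ₖ σ) - ρ).PosSemidef},
    ((l : ℝ) : EReal)

/-- The min-entropy `H_min(A|B)_ρ` of `A` conditioned on `B`: the supremum of the above over all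
normalized states `σ_B`. -/
def condMinEntropy {A B : Type*} [Fintype A] [DecidableEq A] [Fintype B]
    (ρ : Matrix (A × B) (A × B) ℂ) : EReal :=
  ⨆ σ : {σ : Matrix B B ℂ // IsNormState σ}, condMinEntropyRel ρ σ

/-- `Γ_C(ρ_AB | σ_B) = tr ((ρ_AB (1_A ⊗ σ_B^(-1/2)))²)`, whose binary logarithm is minus the
collision entropy of `A` conditioned on `B`. The trace is real for Hermitian arguments. -/
def collisionGamma {A B : Type*} [Fintype A] [DecidableEq A] [Fintype B] [DecidableEq B]
    (ρ : Matrix (A × B) (A × B) ℂ) (σ : Matrix B B ℂ) : ℝ :=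
  ((ρ * ((1 : Matrix A A ℂ) ⊗ₖ psdInvSqrt σ)) ^ 2).trace.re

end

/-!
By rescaling, `2 ^ (-H_min(X|B)_ρ)` is the least trace `T` of a positive semi-definite `S` on `B`
with `ρ ≤ 1 ⊗ S`; the minimum exists by compactness and is positive because `tr ρ ≤ |X| T`. This
gives finiteness (`condMinEntropy_eq_of_minimal`). If `ρ ≤ K (1 ⊗ σ)`, then conjugating by
`1 ⊗ σ^(-1/2)` shows `Γ_C(ρ|σ) ≤ K tr ρ` (`collisionGamma_le`), so `σ = S / T` proves the first
bound.

For the second bound, let `Λ = ρ_B^(-1/2) S ρ_B^(-1/2)`, fix `c > 0`, let `f` be the function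
`max 0 (1 - t / c)` of `Λ`, and put `V = ρ_B^(1/2) f ρ_B^(-1/2)`. The matrix
`(1 ⊗ V) ρ (1 ⊗ V)†` is at most `1 ⊗ ρ_B^(1/2) f Λ f ρ_B^(1/2) ≤ c (1 ⊗ ρ_B)`. Its marginal
falls short of `ρ_B` by a positive semi-definite `Y ≤ ρ_B`; adding `|X|⁻¹ (1 ⊗ Y)` gives a CQ
matrix `ρ'` with marginal `ρ_B` and `ρ' ≤ (c + |X|⁻¹) (1 ⊗ ρ_B)` (`exists_smoothing`). By
`collisionGamma_le` and `tr ρ ≤ |X| T`, this yields `Γ_C(ρ'|ρ_B) ≤ c + T`.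

The distance is controlled by `tr |√ρ √τ| ≥ Re tr (G ρ)` whenever `G ρ G† ≤ τ`
(`re_trace_mul_le_fidelity`, from Douglas' factorization lemma). With `G = 1 ⊗ V` the right side is
`tr (ρ_B f) ≥ tr ρ - T / c`, since `1 - f ≤ Λ / c` and `tr (ρ_B Λ) ≤ tr S`. The choice
`c = 2 T / ε²` makes the loss `ε² / 2`, and `1 - (1 - ε² / 2)² ≤ ε²`.
-/

open Matrix
open scoped MatrixOrder

/-! ### Square roots, inverse square roots and support projections -/

section

variable {n : Type*} [Fintype n] [DecidableEq n]

/-- Every real function is continuous on the (finite) spectrum of a matrix, so the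
functional calculus below applies also to the discontinuous functions that define
`psdInvSqrt` and `supportProj`. -/
lemma continuousOn_spectrum_matrix (σ : Matrix n n ℂ) (f : ℝ → ℝ) :
    ContinuousOn f (spectrum ℝ σ) :=
  (Matrix.finite_real_spectrum (A := σ)).continuousOn f

/-- The orthogonal projection onto the support of a positive semi-definite matrix. -/
noncomputable def supportProj (σ : Matrix n n ℂ) : Matrix n n ℂ :=
  cfc (fun x : ℝ => if x = 0 then 0 else 1) σ

lemma spectrum_nonneg_of_posSemidef {σ : Matrix n n ℂ} (hσ : σ.PosSemidef) {x : ℝ}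
    (hx : x ∈ spectrum ℝ σ) : 0 ≤ x :=
  spectrum_nonneg_of_nonneg (nonneg_iff_posSemidef.2 hσ) hx

lemma psdSqrt_posSemidef (σ : Matrix n n ℂ) : (psdSqrt σ).PosSemidef :=
  nonneg_iff_posSemidef.1 (cfc_nonneg fun x _ => Real.sqrt_nonneg x)

lemma psdSqrt_isHermitian (σ : Matrix n n ℂ) : (psdSqrt σ).IsHermitian :=
  (psdSqrt_posSemidef σ).1

lemma psdInvSqrt_isHermitian (σ : Matrix n n ℂ) : (psdInvSqrt σ).IsHermitian :=
  cfc_predicate (p := IsSelfAdjoint) _ σ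

lemma supportProj_isHermitian (σ : Matrix n n ℂ) : (supportProj σ).IsHermitian :=
  cfc_predicate (p := IsSelfAdjoint) _ σ

lemma supportProj_le_one (σ : Matrix n n ℂ) : supportProj σ ≤ 1 :=
  cfc_le_one _ _ fun x _ => by split_ifs <;> norm_num

lemma psdSqrt_mul_psdSqrt {σ : Matrix n n ℂ} (hσ : σ.PosSemidef) :
    psdSqrt σ * psdSqrt σ = σ := by
  have hc := continuousOn_spectrum_matrix σ
  rw [psdSqrt, ← cfc_mul _ _ σ (hc _) (hc _)]
  conv_rhs => rw [← cfc_id ℝ σ hσ.1]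
  exact cfc_congr fun x hx => Real.mul_self_sqrt (spectrum_nonneg_of_posSemidef hσ hx)

lemma psdInvSqrt_mul_psdSqrt {σ : Matrix n n ℂ} (hσ : σ.PosSemidef) :
    psdInvSqrt σ * psdSqrt σ = supportProj σ := by
  have hc := continuousOn_spectrum_matrix σ
  rw [psdSqrt, psdInvSqrt, ← cfc_mul _ _ σ (hc _) (hc _)]
  refine cfc_congr fun x hx => ?_
  have h0 := spectrum_nonneg_of_posSemidef hσ hx
  by_cases h : x = 0
  · simp [h]
  · have : Real.sqrt x ≠ 0 := (Real.sqrt_pos.2 (lt_of_le_of_ne h0 (Ne.symm h))).ne'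
    simp [h, this]

lemma psdSqrt_mul_psdInvSqrt {σ : Matrix n n ℂ} (hσ : σ.PosSemidef) :
    psdSqrt σ * psdInvSqrt σ = supportProj σ := by
  have := congrArg conjTranspose (psdInvSqrt_mul_psdSqrt hσ)
  rwa [conjTranspose_mul, (psdSqrt_isHermitian σ).eq, (psdInvSqrt_isHermitian σ).eq,
    (supportProj_isHermitian σ).eq] at this

lemma supportProj_mul_psdSqrt (σ : Matrix n n ℂ) :
    supportProj σ * psdSqrt σ = psdSqrt σ := by
  have hc := continuousOn_spectrum_matrix σ
  rw [psdSqrt, supportProj, ← cfc_mul _ _ σ (hc _) (hc _)]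
  refine cfc_congr fun x _ => ?_
  by_cases h : x = 0 <;> simp [h]

lemma psdSqrt_mul_supportProj (σ : Matrix n n ℂ) :
    psdSqrt σ * supportProj σ = psdSqrt σ := by
  have := congrArg conjTranspose (supportProj_mul_psdSqrt σ)
  rwa [conjTranspose_mul, (psdSqrt_isHermitian σ).eq, (supportProj_isHermitian σ).eq] at this

lemma supportProj_mul_supportProj {σ : Matrix n n ℂ} (hσ : σ.PosSemidef) :
    supportProj σ * supportProj σ = supportProj σ := by
  conv_lhs => rw [← psdInvSqrt_mul_psdSqrt hσ, Matrix.mul_assoc, psdInvSqrt_mul_psdSqrt hσ,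
    psdSqrt_mul_supportProj σ, psdInvSqrt_mul_psdSqrt hσ]

lemma supportProj_posSemidef {σ : Matrix n n ℂ} (hσ : σ.PosSemidef) :
    (supportProj σ).PosSemidef := by
  have := posSemidef_conjTranspose_mul_self (supportProj σ)
  rwa [(supportProj_isHermitian σ).eq, supportProj_mul_supportProj hσ] at this

lemma supportProj_mul_self {σ : Matrix n n ℂ} (hσ : σ.PosSemidef) : supportProj σ * σ = σ := by
  calc supportProj σ * σ = supportProj σ * (psdSqrt σ * psdSqrt σ) := by
        rw [psdSqrt_mul_psdSqrt hσ]
    _ = σ := by rw [← Matrix.mul_assoc, supportProj_mul_psdSqrt σ, psdSqrt_mul_psdSqrt hσ]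

lemma psdInvSqrt_mul_self {σ : Matrix n n ℂ} (hσ : σ.PosSemidef) :
    psdInvSqrt σ * σ = psdSqrt σ := by
  calc psdInvSqrt σ * σ = psdInvSqrt σ * (psdSqrt σ * psdSqrt σ) := by
        rw [psdSqrt_mul_psdSqrt hσ]
    _ = psdSqrt σ := by
        rw [← Matrix.mul_assoc, psdInvSqrt_mul_psdSqrt hσ, supportProj_mul_psdSqrt σ]

lemma psdInvSqrt_mul_self_mul_psdInvSqrt {σ : Matrix n n ℂ} (hσ : σ.PosSemidef) :
    psdInvSqrt σ * σ * psdInvSqrt σ = supportProj σ := by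
  rw [psdInvSqrt_mul_self hσ, psdSqrt_mul_psdInvSqrt hσ]

end

/-! ### Traces, conjugations and Kronecker products in the Loewner order -/

section

variable {n A B : Type*}

lemma smul_le_smul_ofReal {M N : Matrix n n ℂ} {r : ℝ} (hr : 0 ≤ r) (h : M ≤ N) :
    (r : ℂ) • M ≤ (r : ℂ) • N := by
  rw [le_iff, ← smul_sub]
  exact (le_iff.1 h).smul (Complex.zero_le_real.2 hr)

variable [Fintype n]

lemma conjTranspose_mul_mul_le {M N : Matrix n n ℂ} (h : M ≤ N) (C : Matrix n n ℂ) :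
    Cᴴ * M * C ≤ Cᴴ * N * C :=
  star_left_conjugate_le_conjugate h C

lemma mul_mul_conjTranspose_le {M N : Matrix n n ℂ} (h : M ≤ N) (C : Matrix n n ℂ) :
    C * M * Cᴴ ≤ C * N * Cᴴ :=
  star_right_conjugate_le_conjugate h C

lemma conj_le_of_isHermitian {M N C : Matrix n n ℂ} (h : M ≤ N) (hC : C.IsHermitian) :
    C * M * C ≤ C * N * C := by
  simpa only [hC.eq] using conjTranspose_mul_mul_le h C

lemma re_trace_mono {M N : Matrix n n ℂ} (h : M ≤ N) : M.trace.re ≤ N.trace.re := by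
  have := (Complex.le_def.1 (le_iff.1 h).trace_nonneg).1
  rw [trace_sub, Complex.sub_re, Complex.zero_re] at this
  linarith

lemma re_trace_smul (r : ℝ) (M : Matrix n n ℂ) : ((r : ℂ) • M).trace.re = r * M.trace.re := by
  simp [trace_smul]

lemma one_kronecker_mono [Fintype A] [DecidableEq A] [Fintype B] {M N : Matrix B B ℂ} (h : M ≤ N) :
    (1 : Matrix A A ℂ) ⊗ₖ M ≤ (1 : Matrix A A ℂ) ⊗ₖ N := by
  have := (PosSemidef.one : (1 : Matrix A A ℂ).PosSemidef).kronecker (le_iff.1 h)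
  rw [le_iff]
  convert this using 1
  ext ⟨a, b⟩ ⟨a', b'⟩
  simp [kroneckerMap_apply, mul_sub]

lemma one_kronecker_mul [Fintype A] [DecidableEq A] [Fintype B] (M N : Matrix B B ℂ) :
    ((1 : Matrix A A ℂ) ⊗ₖ M) * ((1 : Matrix A A ℂ) ⊗ₖ N) = (1 : Matrix A A ℂ) ⊗ₖ (M * N) := by
  rw [← mul_kronecker_mul, Matrix.one_mul]

lemma one_kronecker_conjTranspose [DecidableEq A] (M : Matrix B B ℂ) :
    ((1 : Matrix A A ℂ) ⊗ₖ M)ᴴ = (1 : Matrix A A ℂ) ⊗ₖ Mᴴ := by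
  rw [conjTranspose_kronecker, conjTranspose_one]

lemma re_trace_mul_mono [DecidableEq n] {D M N : Matrix n n ℂ} (hD : D.PosSemidef) (h : M ≤ N) :
    (D * M).trace.re ≤ (D * N).trace.re := by
  have key : ∀ K : Matrix n n ℂ, (psdSqrt D * K * psdSqrt D).trace = (D * K).trace := by
    intro K
    rw [trace_mul_comm, ← Matrix.mul_assoc, psdSqrt_mul_psdSqrt hD]
  have := re_trace_mono (conj_le_of_isHermitian h (psdSqrt_isHermitian D))
  rwa [key, key] at this

end

/-! ### Collision entropy -/

/-- Conjugating `ρ ≤ K (1 ⊗ σ)` by `1 ⊗ σ^(-1/2)` gives an operator at most `K`, and `Γ_C` is the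
trace of `ρ` against it. -/
lemma collisionGamma_le {A B : Type*} [Fintype A] [DecidableEq A] [Fintype B] [DecidableEq B]
    {ρ : Matrix (A × B) (A × B) ℂ} {σ : Matrix B B ℂ} {K : ℝ} (hK : 0 ≤ K)
    (hρ : ρ.PosSemidef) (hσ : σ.PosSemidef) (h : ρ ≤ (K : ℂ) • ((1 : Matrix A A ℂ) ⊗ₖ σ)) :
    collisionGamma ρ σ ≤ K * ρ.trace.re := by
  set W := (1 : Matrix A A ℂ) ⊗ₖ psdInvSqrt σ with hW
  have hWh : W.IsHermitian := by
    rw [IsHermitian, hW, one_kronecker_conjTranspose, (psdInvSqrt_isHermitian σ).eq]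
  have h1 : W * ρ * W ≤ (K : ℂ) • 1 := by
    refine (conj_le_of_isHermitian h hWh).trans ?_
    rw [Matrix.mul_smul, Matrix.smul_mul, hW, one_kronecker_mul, one_kronecker_mul,
      psdInvSqrt_mul_self_mul_psdInvSqrt hσ]
    refine smul_le_smul_ofReal hK ?_
    rw [← one_kronecker_one (α := ℂ) (m := A) (n := B)]
    exact one_kronecker_mono (supportProj_le_one σ)
  have h2 := re_trace_mul_mono hρ h1
  rw [Matrix.mul_smul, Matrix.mul_one, re_trace_smul] at h2
  rw [collisionGamma, ← hW, pow_two]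
  simpa only [Matrix.mul_assoc] using h2

/-! ### A lower bound on the fidelity -/

section

variable {n : Type*} [Fintype n] [DecidableEq n]

/-- Douglas' factorization lemma. The contraction is `M τ^(-1/2)`; the hypothesis makes `M` vanish
on the kernel of `τ`. -/
lemma exists_contraction_mul_psdSqrt {M τ : Matrix n n ℂ} (hτ : τ.PosSemidef) (h : Mᴴ * M ≤ τ) :
    ∃ C : Matrix n n ℂ, Cᴴ * C ≤ 1 ∧ C * psdSqrt τ = M := by
  refine ⟨M * psdInvSqrt τ, ?_, ?_⟩
  · have := conj_le_of_isHermitian h (psdInvSqrt_isHermitian τ)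
    rw [psdInvSqrt_mul_self_mul_psdInvSqrt hτ] at this
    rw [conjTranspose_mul, (psdInvSqrt_isHermitian τ).eq]
    refine le_trans (le_of_eq ?_) (this.trans (supportProj_le_one τ))
    simp only [Matrix.mul_assoc]
  · have hE : (1 - supportProj τ).IsHermitian := isHermitian_one.sub (supportProj_isHermitian τ)
    have h0 := conj_le_of_isHermitian h hE
    have h1 : (1 - supportProj τ) * τ * (1 - supportProj τ) = 0 := by
      have : (1 - supportProj τ) * τ = 0 := by
        rw [Matrix.sub_mul, supportProj_mul_self hτ, Matrix.one_mul, sub_self]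
      rw [this, Matrix.zero_mul]
    have h2 : (M * (1 - supportProj τ))ᴴ * (M * (1 - supportProj τ)) = 0 := by
      refine le_antisymm ?_ (nonneg_iff_posSemidef.2 (posSemidef_conjTranspose_mul_self _))
      rw [conjTranspose_mul, hE.eq]
      refine le_trans (le_of_eq ?_) (h0.trans h1.le)
      simp only [Matrix.mul_assoc]
    have h3 := conjTranspose_mul_self_eq_zero.1 h2
    rw [Matrix.mul_sub, Matrix.mul_one, sub_eq_zero] at h3
    rw [Matrix.mul_assoc, psdInvSqrt_mul_psdSqrt hτ, ← h3]

/-- The easy half of the variational formula for the trace norm: with `N = W |N|` and `W` a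
contraction, expand `tr (|N| (C - W)† (C - W)) ≥ 0`. -/
lemma re_trace_mul_conjTranspose_le_trace_matrixAbs (N : Matrix n n ℂ) {C : Matrix n n ℂ}
    (hC : Cᴴ * C ≤ 1) : (N * Cᴴ).trace.re ≤ (matrixAbs N).trace.re := by
  obtain ⟨W, hW, hWN⟩ := exists_contraction_mul_psdSqrt
    (posSemidef_conjTranspose_mul_self N) (le_refl (Nᴴ * N))
  set D := matrixAbs N with hD
  change W * D = N at hWN
  have hDp : D.PosSemidef := psdSqrt_posSemidef _
  have h0 : 0 ≤ (D * ((C - W)ᴴ * (C - W))).trace.re := by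
    have := re_trace_mul_mono hDp (nonneg_iff_posSemidef.2
      (posSemidef_conjTranspose_mul_self (C - W)))
    simpa using this
  have h1 := re_trace_mul_mono hDp hC
  have h2 := re_trace_mul_mono hDp hW
  have h3 : (D * (Cᴴ * W)).trace = (N * Cᴴ).trace := by
    rw [← hWN, Matrix.mul_assoc, trace_mul_comm W, Matrix.mul_assoc]
  have h4 : (D * (Wᴴ * C)).trace.re = (D * (Cᴴ * W)).trace.re := by
    have : (D * (Wᴴ * C)).trace = star ((D * (Cᴴ * W)).trace) := by
      rw [← trace_conjTranspose, conjTranspose_mul, conjTranspose_mul, hDp.1.eq,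
        conjTranspose_conjTranspose, trace_mul_comm]
    rw [this]; rfl
  rw [conjTranspose_sub, Matrix.sub_mul, Matrix.mul_sub, Matrix.mul_sub] at h0
  simp only [Matrix.mul_sub, trace_sub, Complex.sub_re] at h0
  rw [Matrix.mul_one] at h1 h2
  rw [h3] at h4 h0
  linarith

/-- If `√ρ G† = C √τ` with a contraction `C`, then `tr (G ρ) = tr (√ρ √τ C†)`, which is at most the
trace norm of `√ρ √τ`. -/
lemma re_trace_mul_le_fidelity {ρ τ G : Matrix n n ℂ} (hρ : ρ.PosSemidef) (hτ : τ.PosSemidef)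
    (h : G * ρ * Gᴴ ≤ τ) :
    (G * ρ).trace.re ≤ (matrixAbs (psdSqrt ρ * psdSqrt τ)).trace.re := by
  have hM : (psdSqrt ρ * Gᴴ)ᴴ * (psdSqrt ρ * Gᴴ) ≤ τ := by
    refine le_trans (le_of_eq ?_) h
    rw [conjTranspose_mul, conjTranspose_conjTranspose, (psdSqrt_isHermitian ρ).eq]
    conv_rhs => rw [← psdSqrt_mul_psdSqrt hρ]
    simp only [Matrix.mul_assoc]
  obtain ⟨C, hC, hCM⟩ := exists_contraction_mul_psdSqrt hτ hM
  have h1 : G * psdSqrt ρ = psdSqrt τ * Cᴴ := by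
    have := congrArg conjTranspose hCM
    rw [conjTranspose_mul, conjTranspose_mul, conjTranspose_conjTranspose,
      (psdSqrt_isHermitian ρ).eq, (psdSqrt_isHermitian τ).eq] at this
    exact this.symm
  have h2 : (G * ρ).trace = (psdSqrt ρ * psdSqrt τ * Cᴴ).trace := by
    conv_lhs => rw [← psdSqrt_mul_psdSqrt hρ]
    rw [← Matrix.mul_assoc, h1, trace_mul_comm]
    simp only [Matrix.mul_assoc]
  rw [h2]
  exact re_trace_mul_conjTranspose_le_trace_matrixAbs _ hC

/-- With equal traces the second term of the generalized fidelity is `1 - tr ρ`. -/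
lemma purifiedDist_le {ρ τ : Matrix n n ℂ} {ε : ℝ} (hε : 0 < ε) (hρ : ρ.trace.re ≤ 1)
    (htr : τ.trace = ρ.trace)
    (h : ρ.trace.re - ε ^ 2 / 2 ≤ (matrixAbs (psdSqrt ρ * psdSqrt τ)).trace.re) :
    purifiedDist ρ τ ≤ ε := by
  have hF : 1 - ε ^ 2 / 2 ≤ genFidelity ρ τ := by
    rw [genFidelity, htr, Real.sqrt_mul_self (by linarith)]
    linarith
  have hF0 : 0 ≤ genFidelity ρ τ := by
    have : 0 ≤ (matrixAbs (psdSqrt ρ * psdSqrt τ)).trace.re :=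
      (Complex.le_def.1 (psdSqrt_posSemidef _).trace_nonneg).1
    exact add_nonneg this (Real.sqrt_nonneg _)
  rw [purifiedDist, Real.sqrt_le_left hε.le]
  -- For `ε² ≥ 2` the bound `hF` is void, but then `ε ≥ 1` and any distance is at most `1`.
  rcases le_total (1 - ε ^ 2 / 2) 0 with h0 | h0
  · nlinarith [sq_nonneg (genFidelity ρ τ)]
  · nlinarith [pow_le_pow_left₀ h0 hF 2, sq_nonneg (ε ^ 2)]

end

/-! ### Minimizing the trace -/

section

variable {n : Type*} [Fintype n]

lemma re_trace_nonneg {S : Matrix n n ℂ} (hS : S.PosSemidef) : 0 ≤ S.trace.re :=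
  (Complex.le_def.1 hS.trace_nonneg).1

lemma ofReal_re_trace {S : Matrix n n ℂ} (hS : S.PosSemidef) : ((S.trace.re : ℝ) : ℂ) = S.trace := by
  apply Complex.ext
  · simp
  · simpa using (Complex.le_def.1 hS.trace_nonneg).2

lemma isClosed_posSemidef : IsClosed {S : Matrix n n ℂ | S.PosSemidef} := by
  have : {S : Matrix n n ℂ | S.PosSemidef} =
      {S | Sᴴ = S} ∩ ⋂ x : n → ℂ, {S | 0 ≤ star x ⬝ᵥ (S *ᵥ x)} := by
    ext S
    simp [posSemidef_iff_dotProduct_mulVec, IsHermitian]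
  rw [this]
  refine (isClosed_eq (by fun_prop) continuous_id).inter (isClosed_iInter fun x => ?_)
  exact isClosed_le continuous_const (by fun_prop)

variable [DecidableEq n]

lemma le_trace_smul_one {S : Matrix n n ℂ} (hS : S.PosSemidef) :
    S ≤ algebraMap ℝ (Matrix n n ℂ) S.trace.re := by
  refine le_algebraMap_of_spectrum_le (fun x hx => ?_) hS.1
  rw [hS.1.spectrum_real_eq_range_eigenvalues] at hx
  obtain ⟨i, rfl⟩ := hx
  have h : S.trace.re = ∑ j, hS.1.eigenvalues j := by
    rw [hS.1.trace_eq_sum_eigenvalues]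
    simp
  rw [h]
  exact Finset.single_le_sum (fun j _ => hS.eigenvalues_nonneg j) (Finset.mem_univ i)

open scoped Matrix.Norms.L2Operator in
/-- The norm of a positive semi-definite matrix is at most its trace, so trace-sublevel sets of `C`
are compact. -/
lemma exists_trace_minimizer {C : Set (Matrix n n ℂ)} (hC : IsClosed C) (hne : C.Nonempty)
    (hpos : ∀ S ∈ C, S.PosSemidef) :
    ∃ S ∈ C, ∀ S' ∈ C, S.trace.re ≤ S'.trace.re := by
  obtain ⟨S₀, hS₀⟩ := hne
  have hcont : Continuous fun S : Matrix n n ℂ => S.trace.re := by fun_prop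
  set K := C ∩ {S : Matrix n n ℂ | S.trace.re ≤ S₀.trace.re} with hK
  have : ProperSpace (Matrix n n ℂ) := FiniteDimensional.proper ℂ _
  have hKc : IsCompact K := by
    refine Metric.isCompact_of_isClosed_isBounded
      (hC.inter (isClosed_le hcont continuous_const)) ?_
    refine (Metric.isBounded_closedBall (x := (0 : Matrix n n ℂ)) (r := S₀.trace.re)).subset ?_
    rintro S ⟨hS, hS'⟩
    rw [mem_closedBall_zero_iff]
    refine le_trans ?_ hS'
    exact (CStarAlgebra.norm_le_iff_le_algebraMap S (re_trace_nonneg (hpos S hS))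
      (nonneg_iff_posSemidef.2 (hpos S hS))).2 (le_trace_smul_one (hpos S hS))
  obtain ⟨S, hS, hmin⟩ := hKc.exists_isMinOn ⟨S₀, hS₀, le_refl S₀.trace.re⟩ hcont.continuousOn
  refine ⟨S, hS.1, fun S' hS' => ?_⟩
  rcases le_total S'.trace.re S₀.trace.re with h | h
  · exact hmin ⟨hS', h⟩
  · exact hS.2.trans h

end

/-! ### Partial traces and classical-quantum matrices -/

section

variable {X B : Type*} [Fintype X]

lemma marginalB_eq_sum (ρ : Matrix (X × B) (X × B) ℂ) :
    marginalB ρ = ∑ a, ρ.submatrix (fun i => (a, i)) (fun i => (a, i)) := by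
  ext i j
  simp [marginalB, Matrix.sum_apply]

lemma marginalB_add (ρ τ : Matrix (X × B) (X × B) ℂ) :
    marginalB (ρ + τ) = marginalB ρ + marginalB τ := by
  simp [marginalB_eq_sum, submatrix_add, Finset.sum_add_distrib]

lemma marginalB_posSemidef {ρ : Matrix (X × B) (X × B) ℂ} (hρ : ρ.PosSemidef) :
    (marginalB ρ).PosSemidef := by
  rw [marginalB_eq_sum]
  exact posSemidef_sum _ fun a _ => hρ.submatrix _

lemma marginalB_one_kronecker [DecidableEq X] (Y : Matrix B B ℂ) :
    marginalB ((1 : Matrix X X ℂ) ⊗ₖ Y) = (Fintype.card X : ℂ) • Y := by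
  ext i j
  simp [marginalB, kroneckerMap_apply]

lemma one_kronecker_eq_sum [DecidableEq X] (Y : Matrix B B ℂ) :
    (1 : Matrix X X ℂ) ⊗ₖ Y = ∑ x, single x x (1 : ℂ) ⊗ₖ Y := by
  ext ⟨a, i⟩ ⟨b, j⟩
  simp [Matrix.sum_apply, kroneckerMap_apply, single_apply, one_apply, ite_and]

variable [Fintype B]

lemma trace_marginalB (ρ : Matrix (X × B) (X × B) ℂ) : (marginalB ρ).trace = ρ.trace := by
  simp only [trace, marginalB, diag_apply, of_apply, Fintype.sum_prod_type]
  exact Finset.sum_comm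

lemma marginalB_conj [DecidableEq X] (G H : Matrix B B ℂ) (ρ : Matrix (X × B) (X × B) ℂ) :
    marginalB ((1 : Matrix X X ℂ) ⊗ₖ G * ρ * (1 : Matrix X X ℂ) ⊗ₖ H) =
      G * marginalB ρ * H := by
  rw [marginalB_eq_sum, marginalB_eq_sum, Matrix.mul_sum, Matrix.sum_mul]
  refine Finset.sum_congr rfl fun a _ => ?_
  ext i j
  simp [Matrix.mul_apply, Fintype.sum_prod_type, one_apply]

lemma trace_one_kronecker_mul [DecidableEq X] [DecidableEq B] (G : Matrix B B ℂ)
    (ρ : Matrix (X × B) (X × B) ℂ) :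
    ((1 : Matrix X X ℂ) ⊗ₖ G * ρ).trace = (G * marginalB ρ).trace := by
  have := marginalB_conj G 1 ρ
  rw [one_kronecker_one, Matrix.mul_one, Matrix.mul_one] at this
  rw [← this, trace_marginalB]

variable [DecidableEq X]

lemma isCQ_one_kronecker {Y : Matrix B B ℂ} (hY : Y.PosSemidef) :
    IsCQ ((1 : Matrix X X ℂ) ⊗ₖ Y) :=
  ⟨fun _ => Y, fun _ => hY, one_kronecker_eq_sum Y⟩

lemma IsCQ.add {ρ τ : Matrix (X × B) (X × B) ℂ} (hρ : IsCQ ρ) (hτ : IsCQ τ) : IsCQ (ρ + τ) := by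
  obtain ⟨r, hr, rfl⟩ := hρ
  obtain ⟨t, ht, rfl⟩ := hτ
  refine ⟨fun x => r x + t x, fun x => (hr x).add (ht x), ?_⟩
  rw [← Finset.sum_add_distrib]
  exact Finset.sum_congr rfl fun x _ => (kronecker_add _ _ _).symm

lemma IsCQ.conj {ρ : Matrix (X × B) (X × B) ℂ} (hρ : IsCQ ρ) (G : Matrix B B ℂ) :
    IsCQ ((1 : Matrix X X ℂ) ⊗ₖ G * ρ * ((1 : Matrix X X ℂ) ⊗ₖ G)ᴴ) := by
  obtain ⟨r, hr, rfl⟩ := hρ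
  refine ⟨fun x => G * r x * Gᴴ, fun x => (hr x).mul_mul_conjTranspose_same G, ?_⟩
  rw [one_kronecker_conjTranspose, Matrix.mul_sum, Matrix.sum_mul]
  refine Finset.sum_congr rfl fun x _ => ?_
  rw [← mul_kronecker_mul, ← mul_kronecker_mul, Matrix.one_mul, Matrix.mul_one]

end

/-! ### The min-entropy as a trace minimum -/

section

variable {X B : Type*} [Fintype X] [DecidableEq X] [Fintype B]

lemma re_trace_le_of_le_one_kronecker {ρ : Matrix (X × B) (X × B) ℂ} {S : Matrix B B ℂ}
    (h : ρ ≤ (1 : Matrix X X ℂ) ⊗ₖ S) : ρ.trace.re ≤ Fintype.card X * S.trace.re := by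
  have := re_trace_mono h
  simpa [trace_kronecker] using this

lemma exists_minimal_one_kronecker [DecidableEq B] {ρ : Matrix (X × B) (X × B) ℂ} (hρ : ρ.PosSemidef) :
    ∃ S : Matrix B B ℂ, S.PosSemidef ∧ ρ ≤ (1 : Matrix X X ℂ) ⊗ₖ S ∧
      ∀ S' : Matrix B B ℂ, S'.PosSemidef → ρ ≤ (1 : Matrix X X ℂ) ⊗ₖ S' →
        S.trace.re ≤ S'.trace.re := by
  have hcont : Continuous fun S : Matrix B B ℂ => (1 : Matrix X X ℂ) ⊗ₖ S - ρ := by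
    refine (continuous_matrix fun i j => ?_).sub continuous_const
    simp only [kroneckerMap_apply]
    fun_prop
  have hne : ({S : Matrix B B ℂ | S.PosSemidef} ∩
      {S | ((1 : Matrix X X ℂ) ⊗ₖ S - ρ).PosSemidef}).Nonempty := by
    refine ⟨(ρ.trace.re : ℂ) • 1, PosSemidef.one.smul
      (Complex.zero_le_real.2 (re_trace_nonneg hρ)), ?_⟩
    have h := le_trace_smul_one hρ
    have e : algebraMap ℝ (Matrix (X × B) (X × B) ℂ) ρ.trace.re =
        (1 : Matrix X X ℂ) ⊗ₖ ((ρ.trace.re : ℂ) • (1 : Matrix B B ℂ)) := by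
      rw [kronecker_smul, one_kronecker_one, Algebra.algebraMap_eq_smul_one, Complex.coe_smul]
    rw [e] at h
    exact h
  obtain ⟨S, hS, hmin⟩ := exists_trace_minimizer
    (isClosed_posSemidef.inter (isClosed_posSemidef.preimage hcont)) hne fun S hS => hS.1
  exact ⟨S, hS.1, hS.2, fun S' h1 h2 => hmin S' ⟨h1, h2⟩⟩

/-- Feasible pairs `(σ, l)` correspond to feasible `S = 2^(-l) σ`, with `tr S = 2^(-l)`. -/
lemma condMinEntropy_eq_of_minimal {ρ : Matrix (X × B) (X × B) ℂ} {S : Matrix B B ℂ}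
    (hS : S.PosSemidef) (hT : 0 < S.trace.re) (hle : ρ ≤ (1 : Matrix X X ℂ) ⊗ₖ S)
    (hmin : ∀ S' : Matrix B B ℂ, S'.PosSemidef → ρ ≤ (1 : Matrix X X ℂ) ⊗ₖ S' →
      S.trace.re ≤ S'.trace.re) :
    condMinEntropy ρ = ((-Real.logb 2 S.trace.re : ℝ) : EReal) := by
  apply le_antisymm
  · refine iSup_le fun σ => iSup_le fun l => EReal.coe_le_coe_iff.2 ?_
    obtain ⟨σ, hσ, hσ1⟩ := σ
    obtain ⟨l, hl⟩ := l
    have hpos : (0 : ℝ) < 2 ^ (-l) := by positivity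
    have h := hmin ((((2 : ℝ) ^ (-l) : ℝ) : ℂ) • σ) (hσ.smul (Complex.zero_le_real.2 hpos.le))
      (by rw [kronecker_smul]; exact hl)
    rw [re_trace_smul, hσ1, Complex.one_re, mul_one] at h
    have := (Real.logb_le_iff_le_rpow one_lt_two hT).2 h
    change l ≤ _
    linarith
  · set T := S.trace.re with hTdef
    have hσ : IsNormState (((T⁻¹ : ℝ) : ℂ) • S) := by
      refine ⟨hS.smul (Complex.zero_le_real.2 (inv_pos.2 hT).le), ?_⟩
      rw [trace_smul, ← ofReal_re_trace hS, ← hTdef, smul_eq_mul, ← Complex.ofReal_mul,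
        inv_mul_cancel₀ hT.ne', Complex.ofReal_one]
    have hl : ((((2 : ℝ) ^ (-(-Real.logb 2 T)) : ℝ) : ℂ) •
        ((1 : Matrix X X ℂ) ⊗ₖ (((T⁻¹ : ℝ) : ℂ) • S)) - ρ).PosSemidef := by
      rw [neg_neg, Real.rpow_logb two_pos (by norm_num) hT, kronecker_smul, smul_smul,
        ← Complex.ofReal_mul, mul_inv_cancel₀ hT.ne', Complex.ofReal_one, one_smul]
      exact hle
    refine le_iSup_of_le (⟨_, hσ⟩ : {σ : Matrix B B ℂ // IsNormState σ}) ?_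
    exact le_iSup_of_le ⟨-Real.logb 2 T, hl⟩ le_rfl

end

/-! ### Smoothing -/

section

/-- The functional calculus of `Λ` for `t ↦ max 0 (1 - t / c)`, a continuous version of the
projection onto the eigenspaces with eigenvalue below `c`. -/
noncomputable def spectralCutoff {n : Type*} [Fintype n] [DecidableEq n] (c : ℝ)
    (Λ : Matrix n n ℂ) : Matrix n n ℂ :=
  cfc (fun t : ℝ => max 0 (1 - t / c)) Λ

variable {n : Type*} [Fintype n] [DecidableEq n] {c : ℝ} {Λ : Matrix n n ℂ}

lemma spectralCutoff_isHermitian (c : ℝ) (Λ : Matrix n n ℂ) : (spectralCutoff c Λ).IsHermitian :=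
  cfc_predicate (p := IsSelfAdjoint) _ Λ

lemma spectralCutoff_mul_spectralCutoff_le_one (hc : 0 < c) (hΛ : Λ.PosSemidef) :
    spectralCutoff c Λ * spectralCutoff c Λ ≤ 1 := by
  have hcont := continuousOn_spectrum_matrix Λ
  rw [spectralCutoff, ← cfc_mul _ _ Λ (hcont _) (hcont _)]
  refine cfc_le_one _ _ fun t ht => ?_
  have h0 : 0 ≤ t / c := div_nonneg (spectrum_nonneg_of_posSemidef hΛ ht) hc.le
  exact mul_le_one₀ (max_le zero_le_one (by linarith)) (le_max_left _ _)
    (max_le zero_le_one (by linarith))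

lemma spectralCutoff_mul_mul_spectralCutoff_le (hc : 0 < c) (hΛ : Λ.PosSemidef) :
    spectralCutoff c Λ * Λ * spectralCutoff c Λ ≤ (c : ℂ) • 1 := by
  have hcont := continuousOn_spectrum_matrix Λ
  have hs : IsSelfAdjoint Λ := hΛ.1
  have e : spectralCutoff c Λ * Λ * spectralCutoff c Λ =
      cfc (fun t : ℝ => max 0 (1 - t / c) * t * max 0 (1 - t / c)) Λ := by
    rw [cfc_mul _ _ Λ (hcont _) (hcont _), cfc_mul _ _ Λ (hcont _) (hcont _),
      cfc_id' ℝ Λ hs]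
    rfl
  have e' : (c : ℂ) • (1 : Matrix n n ℂ) = algebraMap ℝ _ c := by
    rw [Algebra.algebraMap_eq_smul_one, Complex.coe_smul]
  rw [e, e']
  refine cfc_le_algebraMap _ _ _ (fun t ht => ?_) (hcont _)
  have h0 : 0 ≤ t / c := div_nonneg (spectrum_nonneg_of_posSemidef hΛ ht) hc.le
  rcases le_total (1 - t / c) 0 with h | h
  · rw [max_eq_left h]
    linarith
  · rw [max_eq_right h]
    have ht0 : 0 ≤ t := spectrum_nonneg_of_posSemidef hΛ ht
    have htc : t ≤ c := (div_le_one hc).1 (by linarith)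
    calc (1 - t / c) * t * (1 - t / c) ≤ (1 * t) * 1 := by
          gcongr <;> linarith
      _ ≤ c := by linarith

lemma one_sub_spectralCutoff_le (hΛ : Λ.PosSemidef) :
    1 - spectralCutoff c Λ ≤ ((c⁻¹ : ℝ) : ℂ) • Λ := by
  have hcont := continuousOn_spectrum_matrix Λ
  have hs : IsSelfAdjoint Λ := hΛ.1
  have e : 1 - spectralCutoff c Λ = cfc (fun t : ℝ => 1 - max 0 (1 - t / c)) Λ := by
    rw [cfc_sub _ _ Λ (hcont _) (hcont _), cfc_const_one ℝ Λ hs]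
    rfl
  have e' : ((c⁻¹ : ℝ) : ℂ) • Λ = cfc (fun t : ℝ => c⁻¹ * t) Λ := by
    rw [cfc_const_mul_id _ Λ hs, Complex.coe_smul]
  rw [e, e']
  refine cfc_mono (fun t _ => ?_) (hcont _) (hcont _)
  have := le_max_right 0 (1 - t / c)
  rw [div_eq_inv_mul] at this ⊢
  linarith

end

/-- The pretty good measurement `ρ_B^(-1/2) ρ ρ_B^(-1/2)` is damped on the part where
`Λ = ρ_B^(-1/2) S ρ_B^(-1/2)` is large; the missing weight is spread uniformly over `X`, which
restores the marginal. -/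
lemma exists_smoothing {X B : Type*} [Fintype X] [DecidableEq X] [Nonempty X] [Fintype B]
    [DecidableEq B] {ρ : Matrix (X × B) (X × B) ℂ} (hρ : ρ.PosSemidef) (hcq : IsCQ ρ)
    {S : Matrix B B ℂ} (hS : S.PosSemidef) (hle : ρ ≤ (1 : Matrix X X ℂ) ⊗ₖ S)
    {c : ℝ} (hc : 0 < c) :
    ∃ ρ' : Matrix (X × B) (X × B) ℂ, ρ'.PosSemidef ∧ IsCQ ρ' ∧ marginalB ρ' = marginalB ρ ∧
      ρ' ≤ ((c + (Fintype.card X : ℝ)⁻¹ : ℝ) : ℂ) • ((1 : Matrix X X ℂ) ⊗ₖ marginalB ρ) ∧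
      ρ.trace.re - c⁻¹ * S.trace.re ≤ (matrixAbs (psdSqrt ρ * psdSqrt ρ')).trace.re := by
  have hσ : (marginalB ρ).PosSemidef := marginalB_posSemidef hρ
  set σ := marginalB ρ with hσdef
  set R := psdSqrt σ with hR
  set Q := psdInvSqrt σ with hQ
  set E := supportProj σ with hE
  have hRh : R.IsHermitian := psdSqrt_isHermitian σ
  have hQh : Q.IsHermitian := psdInvSqrt_isHermitian σ
  set Λ := Q * S * Q with hΛdef
  have hΛ : Λ.PosSemidef := by
    have := hS.mul_mul_conjTranspose_same Q
    rwa [hQh.eq] at this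
  set f := spectralCutoff c Λ with hf
  have hfh : f.IsHermitian := spectralCutoff_isHermitian c Λ
  set V := R * f * Q with hV
  have hVh : Vᴴ = Q * f * R := by
    rw [hV, conjTranspose_mul, conjTranspose_mul, hRh.eq, hfh.eq, hQh.eq, Matrix.mul_assoc]
  have hRR : R * R = σ := psdSqrt_mul_psdSqrt hσ
  set Y := R * (1 - f * E * f) * R with hY
  have hfEf0 : 0 ≤ f * E * f := by
    have := conj_le_of_isHermitian (nonneg_iff_posSemidef.2 (supportProj_posSemidef hσ)) hfh
    simpa using this
  have hfEf1 : f * E * f ≤ 1 := by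
    have := conj_le_of_isHermitian (supportProj_le_one σ) hfh
    rw [Matrix.mul_one] at this
    exact this.trans (spectralCutoff_mul_spectralCutoff_le_one hc hΛ)
  have hY0 : Y.PosSemidef := by
    have := conj_le_of_isHermitian (sub_nonneg.2 hfEf1) hRh
    rw [Matrix.mul_zero, Matrix.zero_mul] at this
    exact nonneg_iff_posSemidef.1 this
  have hYσ : Y ≤ σ := by
    have := conj_le_of_isHermitian (sub_le_self 1 hfEf0) hRh
    rwa [Matrix.mul_one, hRR] at this
  have hd : (0 : ℝ) < (Fintype.card X : ℝ)⁻¹ := by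
    have := Fintype.card_pos (α := X)
    positivity
  set d : ℝ := (Fintype.card X : ℝ)⁻¹ with hddef
  have hdY : (((d : ℝ) : ℂ) • Y).PosSemidef := hY0.smul (Complex.zero_le_real.2 hd.le)
  set τ := (1 : Matrix X X ℂ) ⊗ₖ V * ρ * ((1 : Matrix X X ℂ) ⊗ₖ V)ᴴ with hτ
  have hfill : ((1 : Matrix X X ℂ) ⊗ₖ ((d : ℂ) • Y)).PosSemidef := PosSemidef.one.kronecker hdY
  have hρ' : (τ + (1 : Matrix X X ℂ) ⊗ₖ ((d : ℂ) • Y)).PosSemidef :=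
    (hρ.mul_mul_conjTranspose_same _).add hfill
  have hVσV : V * σ * Vᴴ = R * (f * E * f) * R := by
    rw [hVh, hE, ← psdInvSqrt_mul_self_mul_psdInvSqrt hσ]
    simp only [hV, hQ, Matrix.mul_assoc]
  have hVSV : V * S * Vᴴ = R * (f * Λ * f) * R := by
    rw [hVh]
    simp only [hV, hΛdef, Matrix.mul_assoc]
  refine ⟨τ + (1 : Matrix X X ℂ) ⊗ₖ ((d : ℂ) • Y), hρ', (hcq.conj V).add (isCQ_one_kronecker hdY),
    ?_, ?_, ?_⟩
  · rw [marginalB_add, marginalB_one_kronecker, hτ, one_kronecker_conjTranspose, marginalB_conj,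
      ← hσdef, hVσV, smul_smul, hddef]
    have : (Fintype.card X : ℂ) ≠ 0 := Nat.cast_ne_zero.2 Fintype.card_ne_zero
    rw [Complex.ofReal_inv, Complex.ofReal_natCast, mul_inv_cancel₀ this, one_smul, hY,
      Matrix.mul_sub, Matrix.sub_mul, Matrix.mul_one, hRR]
    abel
  · have h1 : τ ≤ (c : ℂ) • ((1 : Matrix X X ℂ) ⊗ₖ σ) := by
      refine (mul_mul_conjTranspose_le hle _).trans ?_
      rw [one_kronecker_conjTranspose, one_kronecker_mul, one_kronecker_mul, hVSV,
        ← kronecker_smul]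
      refine one_kronecker_mono ?_
      have := conj_le_of_isHermitian (spectralCutoff_mul_mul_spectralCutoff_le hc hΛ) hRh
      rwa [Matrix.mul_smul, Matrix.smul_mul, Matrix.mul_one, hRR] at this
    have h2 : (1 : Matrix X X ℂ) ⊗ₖ ((d : ℂ) • Y) ≤ (d : ℂ) • ((1 : Matrix X X ℂ) ⊗ₖ σ) := by
      rw [← kronecker_smul]
      exact one_kronecker_mono (smul_le_smul_ofReal hd.le hYσ)
    rw [Complex.ofReal_add, add_smul]
    exact add_le_add h1 h2
  · refine le_trans ?_ (re_trace_mul_le_fidelity (G := (1 : Matrix X X ℂ) ⊗ₖ V) hρ hρ'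
      (le_add_of_nonneg_right (nonneg_iff_posSemidef.2 hfill)))
    have e1 : ((1 : Matrix X X ℂ) ⊗ₖ V * ρ).trace = (σ * f).trace := by
      rw [trace_one_kronecker_mul, ← hσdef, hV, Matrix.mul_assoc, psdInvSqrt_mul_self hσ,
        ← hR, Matrix.mul_assoc, trace_mul_comm, Matrix.mul_assoc, hRR, trace_mul_comm]
    have e2 : (σ * Λ).trace = (S * E).trace := by
      have : E = Q * σ * Q := (psdInvSqrt_mul_self_mul_psdInvSqrt hσ).symm
      rw [this, hΛdef, trace_mul_comm, Matrix.mul_assoc, Matrix.mul_assoc, trace_mul_comm]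
      simp only [Matrix.mul_assoc]
    have h1 := re_trace_mul_mono hσ (one_sub_spectralCutoff_le (c := c) hΛ)
    rw [Matrix.mul_smul, re_trace_smul, e2, Matrix.mul_sub, Matrix.mul_one, trace_sub,
      Complex.sub_re, hσdef, trace_marginalB, ← hσdef, ← hf] at h1
    have h2 := re_trace_mul_mono hS (supportProj_le_one σ)
    rw [Matrix.mul_one] at h2
    have h3 := mul_le_mul_of_nonneg_left h2 (inv_pos.2 hc).le
    rw [e1]
    linarith

theorem lemma3 {X B : Type*} [Fintype X] [DecidableEq X] [Fintype B] [DecidableEq B]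
    (ρ : Matrix (X × B) (X × B) ℂ) (hρ : IsSubnormState ρ) (hcq : IsCQ ρ) :
    ∃ h : ℝ, condMinEntropy ρ = (h : EReal) ∧
      (∃ σ : Matrix B B ℂ, IsNormState σ ∧ collisionGamma ρ σ ≤ (2 : ℝ) ^ (-h)) ∧
      (∀ ε : ℝ, 0 < ε →
        ∃ ρ' : Matrix (X × B) (X × B) ℂ,
          ρ' ∈ epsBall ε ρ ∧ IsCQ ρ' ∧ ρ'.trace = ρ.trace ∧
          collisionGamma ρ' (marginalB ρ') ≤
            (2 : ℝ) ^ (-h + Real.logb 2 (2 / ε ^ 2 + 1))) := by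
  obtain ⟨hpos, htr0, htr1⟩ := hρ
  obtain ⟨S, hS, hle, hmin⟩ := exists_minimal_one_kronecker hpos
  have hcard := re_trace_le_of_le_one_kronecker hle
  have hX : (0 : ℝ) < Fintype.card X := by
    rcases Nat.eq_zero_or_pos (Fintype.card X) with h | h
    · rw [h, Nat.cast_zero, zero_mul] at hcard
      linarith
    · exact_mod_cast h
  have : Nonempty X := Fintype.card_pos_iff.1 (by exact_mod_cast hX)
  have hT : 0 < S.trace.re := pos_of_mul_pos_right (htr0.trans_le hcard) hX.le
  set T := S.trace.re with hTdef
  have hpow : (2 : ℝ) ^ (-(-Real.logb 2 T)) = T := by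
    rw [neg_neg, Real.rpow_logb two_pos (by norm_num) hT]
  refine ⟨-Real.logb 2 T, condMinEntropy_eq_of_minimal hS hT hle hmin, ?_, fun ε hε => ?_⟩
  · have hσ0 : (((T⁻¹ : ℝ) : ℂ) • S).PosSemidef :=
      hS.smul (Complex.zero_le_real.2 (inv_pos.2 hT).le)
    refine ⟨((T⁻¹ : ℝ) : ℂ) • S, ⟨hσ0, ?_⟩, ?_⟩
    · rw [trace_smul, ← ofReal_re_trace hS, ← hTdef, smul_eq_mul, ← Complex.ofReal_mul,
        inv_mul_cancel₀ hT.ne', Complex.ofReal_one]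
    · rw [hpow]
      have h1 : ρ ≤ (T : ℂ) • ((1 : Matrix X X ℂ) ⊗ₖ (((T⁻¹ : ℝ) : ℂ) • S)) := by
        rw [kronecker_smul, smul_smul, ← Complex.ofReal_mul, mul_inv_cancel₀ hT.ne',
          Complex.ofReal_one, one_smul]
        exact hle
      exact (collisionGamma_le hT.le hpos hσ0 h1).trans (mul_le_of_le_one_right hT.le htr1)
  · have hc : 0 < 2 * T / ε ^ 2 := by positivity
    obtain ⟨ρ', hpos', hcq', hmarg, hle', hfid⟩ := exists_smoothing hpos hcq hS hle hc
    have htr : ρ'.trace = ρ.trace := by rw [← trace_marginalB, hmarg, trace_marginalB]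
    refine ⟨ρ', ⟨⟨hpos', htr ▸ htr0, htr ▸ htr1⟩, purifiedDist_le hε htr1 htr ?_⟩, hcq', htr, ?_⟩
    · refine le_trans (le_of_eq ?_) hfid
      rw [← hTdef]
      field_simp
    · rw [Real.rpow_add two_pos, hpow, Real.rpow_logb two_pos (by norm_num) (by positivity), hmarg]
      refine (collisionGamma_le (by positivity) hpos' (marginalB_posSemidef hpos) hle').trans ?_
      rw [htr, add_mul, mul_add, mul_one]
      refine add_le_add ?_ ?_
      · calc 2 * T / ε ^ 2 * ρ.trace.re ≤ 2 * T / ε ^ 2 := mul_le_of_le_one_right hc.le htr1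
          _ = T * (2 / ε ^ 2) := by ring
      · rw [inv_mul_le_iff₀ hX]
        exact hcard
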